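/- Let $\Xi$ be a finite non-empty set of experts. There is a constant $c\in\mathbb R$, depending only on $|\Xi|$, such that the following holds for every countable outcome space $\mathcal X$, every family $(P_\xi)_{\xi\in\Xi}$ of forecasting systems on $\mathcal X$ (each $P_\xi$ maps a finite sequence of past outcomes to a probability mass function $P_\xi(\cdot\mid x_1,\ldots,x_{i-1})$ for the next outcome), every $n\ge 1$ and all data $x^n=(x_1,\ldots,x_n)\in\mathcal X^n$. For mixture weights $\alpha\in\triangle(\Xi)$ (the probability simplex on $\Xi$) let the fixed elementwise mixture be $$P_{\mathrm{mix},\alpha}(x^n)=\prod_{i=1}^n\sum_{\xi\in\Xi}P_\xi(x_i\mid x_1,\ldots,x_{i-1})\,\alpha(\xi),$$ and let the universal elementwise mixture be $$P_{\mathrm{umix}}(x^n)=\int_{\triangle(\Xi)}P_{\mathrm{mix},\alpha}(x^n)\,w(\alpha)\,d\alpha,\qquad w(\alpha)=\frac{\Gamma(|\Xi|/2)}{\Gamma(1/2)^{|\Xi|}}\prod_{\xi\in\Xi}\alpha(\xi)^{-1/2},$$ where $w$ is the density of the $(\tfrac12,\ldots,\tfrac12)$-Dirichlet (Jeffreys')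 prior with respect to Lebesgue measure on the simplex in any $|\Xi|-1$ of the coordinates (a point mass if $|\Xi|=1$). Let $\log$ be the natural logarithm and $-\log 0=+\infty$. Then the minimum $\hat L=\min_{\alpha\in\triangle(\Xi)}-\log P_{\mathrm{mix},\alpha}(x^n)$ is attained, and $$-\log P_{\mathrm{umix}}(x^n)\;\le\;\hat L+\frac{|\Xi|-1}{2}\log\frac n\pi+c .$$ In particular, if $\hat L<\infty$, then $-\log P_{\mathrm{umix}}(x^n)-\hat L\le\frac{|\Xi|-1}{2}\log\frac n\pi+c$. -/

import Mathlib

open MeasureTheory Set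
open scoped ENNReal

/-- A prequential forecasting system on `X`: it maps every finite sequence of past outcomes to a
probability mass function for the next outcome. -/
abbrev ForecastingSystem (X : Type*) := List X → PMF X

section Mixtures

variable {Ξ X : Type*} [Fintype Ξ]

/-- One-step prediction `P_α(y | h) = ∑_ξ P_ξ(y | h) α(ξ)` of the elementwise mixture with
weights `α`. -/
noncomputable def mixturePrediction (P : Ξ → ForecastingSystem X) (α : Ξ → ℝ)
    (h : List X) (y : X) : ℝ≥0∞ :=
  ∑ ξ, P ξ h y * ENNReal.ofReal (α ξ)

/-- The fixed elementwise mixture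
`P_{mix,α}(x₁,…,xₙ) = ∏ᵢ P_α(xᵢ | x₁,…,xᵢ₋₁)`. -/
noncomputable def elementwiseMixture (P : Ξ → ForecastingSystem X) (α : Ξ → ℝ)
    {n : ℕ} (x : Fin n → X) : ℝ≥0∞ :=
  ∏ i : Fin n, mixturePrediction P α ((List.ofFn x).take i) (x i)

/-- The universal elementwise mixture with prior `w` on the simplex of mixture weights:
`P_umix(xⁿ) = ∫_{Δ(Ξ)} P_{mix,α}(xⁿ) dw(α)`. -/
noncomputable def universalMixture (w : Measure (Ξ → ℝ)) (P : Ξ → ForecastingSystem X)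
    {n : ℕ} (x : Fin n → X) : ℝ≥0∞ :=
  ∫⁻ α in stdSimplex ℝ Ξ, elementwiseMixture P α x ∂w

/-- The logarithmic loss `-log p`, with value `+∞` at `p = 0`. -/
noncomputable def logLoss (p : ℝ≥0∞) : EReal := -ENNReal.log p

end Mixtures

section Dirichlet

variable {Ξ : Type*} [Fintype Ξ] [DecidableEq Ξ]

/-- The point of the hyperplane `∑ α = 1` whose coordinates other than `ξ₀` are given by `β`;
the coordinate at `ξ₀` is `1 - ∑ β`. -/
def simplexPoint (ξ₀ : Ξ) (β : {ξ : Ξ // ξ ≠ ξ₀} → ℝ) : Ξ → ℝ :=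
  fun ξ => if h : ξ = ξ₀ then 1 - ∑ η, β η else β ⟨ξ, h⟩

theorem measurable_simplexPoint (ξ₀ : Ξ) : Measurable (simplexPoint ξ₀) := by
  refine measurable_pi_lambda _ fun ξ => ?_
  by_cases h : ξ = ξ₀
  · simp only [simplexPoint, h, dite_true]
    fun_prop
  · simp only [simplexPoint, h, dite_false]
    fun_prop

/-- Lebesgue measure `dα` on the probability simplex, in the free coordinates `(α_ξ)_{ξ ≠ ξ₀}`. -/
noncomputable def simplexVolume (ξ₀ : Ξ) : Measure (Ξ → ℝ) :=
  (Measure.map (simplexPoint ξ₀) volume).restrict (stdSimplex ℝ Ξ)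

/-- The Dirichlet density
`Γ(∑ a_ξ) / ∏ Γ(a_ξ) * ∏ α_ξ ^ (a_ξ - 1)` with respect to Lebesgue measure on the simplex. -/
noncomputable def dirichletDensity {Ξ : Type*} [Fintype Ξ] (a : Ξ → ℝ) (α : Ξ → ℝ) : ℝ :=
  Real.Gamma (∑ ξ, a ξ) / (∏ ξ, Real.Gamma (a ξ)) * ∏ ξ, α ξ ^ (a ξ - 1)

/-- The Dirichlet distribution with parameters `a`. The coordinate `ξ₀` is the one eliminated in
writing down Lebesgue measure on the simplex; the distribution does not depend on it. -/
noncomputable def dirichletMeasure (ξ₀ : Ξ) (a : Ξ → ℝ) : Measure (Ξ → ℝ) :=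
  (simplexVolume ξ₀).withDensity fun α => ENNReal.ofReal (dirichletDensity a α)

/-- Jeffreys' prior on mixture weights: the Dirichlet distribution with parameters
`(1/2, …, 1/2)`. -/
noncomputable def jeffreysPrior (ξ₀ : Ξ) : Measure (Ξ → ℝ) :=
  dirichletMeasure ξ₀ fun _ => 1 / 2

end Dirichlet

/-! Expanding the product of sums writes the mixture as a combination of monomials `∏ α ξ ^ m ξ` of
total degree `n`, with nonnegative coefficients free of `α`. So it suffices to compare each monomial
with its Jeffreys moment, uniformly in `m`. That moment is at least a constant times `∏ Γ(m ξ + 1/2)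
/ Γ(n + k/2)` (`le_lintegral_prod_pow_dirichletMeasure`). With `t = n α ξ`, the inequality `t ^ m *
exp (-t) ≤ Γ(m + 1/2)` bounds the numerator below by `(n/e)^n ∏ α ξ ^ m ξ`; the denominator is at
most `C (n/e)^n n^((k-1)/2)`. The loss `n^((k-1)/2)` is the regret, and compactness of the simplex
gives the minimum. -/

/-! ### Estimates for the Gamma function -/

/-- Log-convexity of Γ at the midpoint of `x` and `x + 1`. -/
theorem Real.Gamma_add_half_le_sqrt_mul {x : ℝ} (hx : 0 < x) :
    Real.Gamma (x + 1 / 2) ≤ √x * Real.Gamma x := by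
  have h := Real.Gamma_mul_add_mul_le_rpow_Gamma_mul_rpow_Gamma hx (by linarith : 0 < x + 1)
    (by norm_num : (0 : ℝ) < 1 / 2) (by norm_num : (0 : ℝ) < 1 / 2) (by norm_num)
  have hG := (Real.Gamma_pos_of_pos hx).le
  rw [Real.Gamma_add_one hx.ne', Real.mul_rpow hx.le hG, ← Real.sqrt_eq_rpow,
    ← Real.sqrt_eq_rpow] at h
  have e : 1 / 2 * x + 1 / 2 * (x + 1) = x + 1 / 2 := by ring
  rw [e] at h
  calc _ ≤ _ := h
    _ = √x * (√(Real.Gamma x) * √(Real.Gamma x)) := by ring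
    _ = _ := by rw [Real.mul_self_sqrt hG]

theorem pow_mul_exp_neg_le (m : ℕ) {t : ℝ} (ht : 0 ≤ t) :
    t ^ m * Real.exp (-t) ≤ (m / Real.exp 1) ^ m := by
  rcases eq_or_ne m 0 with rfl | hm
  · simpa using ht
  have hm' : (0 : ℝ) < m := by positivity
  -- The maximum over `t` is at `t = m`, where this inequality is tight.
  have h := Real.add_one_le_exp (t / m - 1)
  have h1 : t ≤ m * Real.exp (t / m - 1) := by
    rw [sub_add_cancel, div_le_iff₀ hm'] at h
    linarith
  calc t ^ m * Real.exp (-t) ≤ (m * Real.exp (t / m - 1)) ^ m * Real.exp (-t) := by gcongr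
    _ = m ^ m * Real.exp (m * (t / m - 1) + -t) := by
      rw [mul_pow, ← Real.exp_nat_mul, Real.exp_add]; ring
    _ = (m / Real.exp 1) ^ m := by
      rw [div_pow, ← Real.exp_nat_mul, div_eq_mul_inv (_ ^ m), ← Real.exp_neg]
      congr 2
      field_simp
      ring

/-- For `m ≥ 1`, Stirling gives `√(2πm) (m/e)^m ≤ m! ≤ √(m + 1/2) Γ(m + 1/2)`, and `m + 1/2 ≤ 2πm`.
-/
theorem pow_mul_exp_neg_le_Gamma_add_half (m : ℕ) {t : ℝ} (ht : 0 ≤ t) :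
    t ^ m * Real.exp (-t) ≤ Real.Gamma (m + 1 / 2) := by
  refine (pow_mul_exp_neg_le m ht).trans ?_
  rcases Nat.eq_zero_or_pos m with rfl | hm
  · have h : (1 : ℝ) ≤ √Real.pi := Real.one_le_sqrt.2 (by linarith [Real.pi_gt_three])
    simpa only [Nat.cast_zero, pow_zero, zero_add, Real.Gamma_one_half_eq] using h
  have hm1 : (1 : ℝ) ≤ m := by exact_mod_cast hm
  have h := Real.Gamma_add_half_le_sqrt_mul (by positivity : (0 : ℝ) < m + 1 / 2)
  rw [add_assoc, add_halves, Real.Gamma_nat_eq_factorial] at h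
  have h3 : √((m : ℝ) + 1 / 2) ≤ √(2 * Real.pi * m) :=
    Real.sqrt_le_sqrt (by nlinarith [Real.pi_gt_three])
  have h4 : √((m : ℝ) + 1 / 2) * (m / Real.exp 1) ^ m ≤ √((m : ℝ) + 1 / 2) *
      Real.Gamma (m + 1 / 2) :=
    (mul_le_mul_of_nonneg_right h3 (by positivity)).trans
      ((Stirling.le_factorial_stirling m).trans h)
  exact le_of_mul_le_mul_left h4 (by positivity)

theorem factorial_le_stirling {n : ℕ} (hn : 1 ≤ n) :
    (n.factorial : ℝ) ≤ Real.exp 1 * √n * (n / Real.exp 1) ^ n := by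
  obtain ⟨m, rfl⟩ : ∃ m, n = m + 1 := ⟨n - 1, by omega⟩
  have h := Stirling.stirlingSeq'_antitone (Nat.zero_le m)
  simp only [Function.comp, Nat.succ_eq_add_one, zero_add, Stirling.stirlingSeq_one] at h
  rw [Stirling.stirlingSeq, div_le_iff₀ (by positivity), Real.sqrt_mul (by norm_num)] at h
  refine h.trans_eq ?_
  have : √(2 : ℝ) ≠ 0 := by positivity
  field_simp

/-- Starting from `Γ(n) = n!/n`, each half-step in the argument costs a factor of at most a constant
times `√n`. -/
theorem exists_Gamma_nat_add_half_mul_le (k : ℕ) : ∃ C : ℝ, 0 < C ∧ ∀ n : ℕ, 1 ≤ n →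
    Real.Gamma (n + k / 2) ≤ C * (n / Real.exp 1) ^ n * (n : ℝ) ^ (((k : ℝ) - 1) / 2) := by
  induction k with
  | zero =>
    refine ⟨Real.exp 1, Real.exp_pos 1, fun n hn => ?_⟩
    have hn' : (0 : ℝ) < n := by positivity
    have h := factorial_le_stirling hn
    rw [← Real.Gamma_nat_eq_factorial, Real.Gamma_add_one hn'.ne'] at h
    have e : (n : ℝ) ^ (((0 : ℕ) - 1 : ℝ) / 2) * n = √n := by
      rw [Real.sqrt_eq_rpow, ← Real.rpow_add_one hn'.ne']
      norm_num
    rw [← e] at h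
    refine le_of_mul_le_mul_left ?_ hn'
    simp only [Nat.cast_zero, zero_div, add_zero] at h ⊢
    linarith
  | succ k ih =>
    obtain ⟨C, hC, h⟩ := ih
    refine ⟨√(1 + k / 2) * C, by positivity, fun n hn => ?_⟩
    have hn' : (1 : ℝ) ≤ n := by exact_mod_cast hn
    have h0 : (0 : ℝ) < n := by positivity
    have e : (n : ℝ) + ((k + 1 : ℕ) : ℝ) / 2 = n + k / 2 + 1 / 2 := by push_cast; ring
    have e' : (((k + 1 : ℕ) : ℝ) - 1) / 2 = ((k : ℝ) - 1) / 2 + 1 / 2 := by push_cast; ring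
    have hs : √((n : ℝ) + k / 2) ≤ √(1 + k / 2) * √n := by
      rw [← Real.sqrt_mul (by positivity)]
      refine Real.sqrt_le_sqrt ?_
      nlinarith [(Nat.cast_nonneg k : (0 : ℝ) ≤ k)]
    rw [e, e', Real.rpow_add h0, ← Real.sqrt_eq_rpow]
    calc _ ≤ _ := Real.Gamma_add_half_le_sqrt_mul (by positivity)
      _ ≤ (√(1 + k / 2) * √n) * (C * (n / Real.exp 1) ^ n * (n : ℝ) ^ (((k : ℝ) - 1) / 2)) :=
        mul_le_mul hs (h n hn) (Real.Gamma_pos_of_pos (by positivity)).le (by positivity)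
      _ = _ := by ring

/-! ### Dirichlet's integral -/

/-- The function `y ↦ y ^ (a - 1)` on the positive half-line, extended by zero. -/
noncomputable def positivePartRpow (a y : ℝ) : ℝ := if 0 < y then y ^ (a - 1) else 0

theorem measurable_positivePartRpow (a : ℝ) : Measurable (positivePartRpow a) :=
  Measurable.ite measurableSet_Ioi (by fun_prop) measurable_const

theorem positivePartRpow_nonneg (a y : ℝ) : 0 ≤ positivePartRpow a y := by
  unfold positivePartRpow
  split_ifs with h
  · exact Real.rpow_nonneg h.le _
  · exact le_rfl

theorem positivePartRpow_mul {s : ℝ} (hs : 0 < s) (a y : ℝ) :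
    positivePartRpow a (s * y) = s ^ (a - 1) * positivePartRpow a y := by
  unfold positivePartRpow
  by_cases h : 0 < y
  · rw [if_pos h, if_pos (mul_pos hs h), Real.mul_rpow hs.le h.le]
  · rw [if_neg h, if_neg (by simpa [hs] using h), mul_zero]

theorem positivePartRpow_mul_exp_neg (a : ℝ) :
    (fun y => positivePartRpow a y * Real.exp (-y)) =
      (Ioi 0).indicator fun y => Real.exp (-y) * y ^ (a - 1) := by
  ext y
  by_cases h : 0 < y <;> simp [positivePartRpow, h, mul_comm]

theorem integrable_positivePartRpow_mul_exp_neg {a : ℝ} (ha : 0 < a) :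
    Integrable fun y => positivePartRpow a y * Real.exp (-y) := by
  rw [positivePartRpow_mul_exp_neg, integrable_indicator_iff measurableSet_Ioi]
  exact Real.GammaIntegral_convergent ha

theorem integral_positivePartRpow_mul_exp_neg {a : ℝ} (ha : 0 < a) :
    ∫ y, positivePartRpow a y * Real.exp (-y) = Real.Gamma a := by
  rw [positivePartRpow_mul_exp_neg, integral_indicator measurableSet_Ioi,
    Real.Gamma_eq_integral ha]

theorem lintegral_positivePartRpow_mul_exp_neg {a : ℝ} (ha : 0 < a) :
    ∫⁻ y, ENNReal.ofReal (positivePartRpow a y * Real.exp (-y)) =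
      ENNReal.ofReal (Real.Gamma a) := by
  rw [← ofReal_integral_eq_lintegral_ofReal (integrable_positivePartRpow_mul_exp_neg ha)
    (Filter.Eventually.of_forall fun y =>
      mul_nonneg (positivePartRpow_nonneg a y) (Real.exp_pos _).le),
    integral_positivePartRpow_mul_exp_neg ha]

theorem lintegral_prod_positivePartRpow_mul_exp_neg {ι : Type*} [Fintype ι] {a : ι → ℝ}
    (ha : ∀ i, 0 < a i) :
    ∫⁻ z : ι → ℝ, ENNReal.ofReal (∏ i, (positivePartRpow (a i) (z i) * Real.exp (-z i))) =
      ENNReal.ofReal (∏ i, Real.Gamma (a i)) := by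
  rw [← ofReal_integral_eq_lintegral_ofReal]
  · rw [integral_fintype_prod_volume_eq_prod fun i y => positivePartRpow (a i) y * Real.exp (-y)]
    simp_rw [integral_positivePartRpow_mul_exp_neg (ha _)]
  · exact Integrable.fintype_prod fun i => integrable_positivePartRpow_mul_exp_neg (ha i)
  · exact Filter.Eventually.of_forall fun z => Finset.prod_nonneg fun i _ =>
      mul_nonneg (positivePartRpow_nonneg _ _) (Real.exp_pos _).le

theorem lintegral_eq_pow_mul_lintegral_comp_smul {ι : Type*} [Fintype ι]
    {f : (ι → ℝ) → ℝ≥0∞} (hf : Measurable f) {s : ℝ} (hs : 0 < s) :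
    ∫⁻ z, f z = ENNReal.ofReal (s ^ Fintype.card ι) * ∫⁻ z, f (s • z) := by
  have h := Measure.map_addHaar_smul (volume : Measure (ι → ℝ)) hs.ne'
  rw [← lintegral_map hf (measurable_const_smul s), h, lintegral_smul_measure,
    Module.finrank_fintype_fun_eq_card, abs_of_pos (by positivity), smul_eq_mul, ← mul_assoc,
    ← ENNReal.ofReal_mul (by positivity), mul_inv_cancel₀ (by positivity), ENNReal.ofReal_one,
    one_mul]

/-- Dirichlet's integral over the simplex, in coordinates where the last weight is
`1 - ∑ z`. -/
theorem dirichlet_lintegral {ι : Type*} [Fintype ι] {a : ι → ℝ} (ha : ∀ i, 0 < a i)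
    {b : ℝ} (hb : 0 < b) :
    ENNReal.ofReal (Real.Gamma (b + ∑ i, a i)) *
      ∫⁻ z : ι → ℝ, ENNReal.ofReal
        (positivePartRpow b (1 - ∑ i, z i) * ∏ i, positivePartRpow (a i) (z i)) =
      ENNReal.ofReal (Real.Gamma b * ∏ i, Real.Gamma (a i)) := by
  set D := ∫⁻ z : ι → ℝ, ENNReal.ofReal
        (positivePartRpow b (1 - ∑ i, z i) * ∏ i, positivePartRpow (a i) (z i)) with hD
  -- The integrand of the product of Gamma integrals, with `s` the sum of all variables. Integrating
  -- over `z` first and rescaling by `s` gives `Γ(b + ∑ a) * D`; integrating over `s` first gives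
  -- the product of Gammas.
  let g : (ι → ℝ) → ℝ → ℝ≥0∞ := fun z s => ENNReal.ofReal
    (positivePartRpow b (s - ∑ i, z i) * (∏ i, positivePartRpow (a i) (z i)) * Real.exp (-s))
  have hm := measurable_positivePartRpow
  have hgm : Measurable (Function.uncurry g) := by
    simp only [g, Function.uncurry_def]
    refine ENNReal.measurable_ofReal.comp ?_
    refine ((hm b).comp (by fun_prop)).mul ?_ |>.mul (by fun_prop)
    exact Finset.measurable_prod _ fun i _ => (hm (a i)).comp (by fun_prop)
  have hg : ∀ s, ∫⁻ z, g z s =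
      ENNReal.ofReal (positivePartRpow (b + ∑ i, a i) s * Real.exp (-s)) * D := by
    intro s
    by_cases hs : 0 < s
    · rw [lintegral_eq_pow_mul_lintegral_comp_smul (f := fun z => g z s)
        (hgm.of_uncurry_right) hs]
      have e : ∀ z : ι → ℝ, g (s • z) s = ENNReal.ofReal (s ^ (b - 1) *
          (∏ i, s ^ (a i - 1)) * Real.exp (-s)) * ENNReal.ofReal
            (positivePartRpow b (1 - ∑ i, z i) * ∏ i, positivePartRpow (a i) (z i)) := by
        intro z
        rw [← ENNReal.ofReal_mul (by positivity)]
        have e1 : s - ∑ i, s * z i = s * (1 - ∑ i, z i) := by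
          rw [← Finset.mul_sum, mul_sub, mul_one]
        simp only [g, Pi.smul_apply, smul_eq_mul, e1, positivePartRpow_mul hs,
          Finset.prod_mul_distrib]
        congr 1
        ring
      simp_rw [e]
      rw [lintegral_const_mul' _ _ ENNReal.ofReal_ne_top, ← mul_assoc,
        ← ENNReal.ofReal_mul (by positivity), ← hD]
      congr 2
      rw [positivePartRpow, if_pos hs, ← Real.rpow_sum_of_pos hs, ← Real.rpow_natCast,
        ← mul_assoc, ← Real.rpow_add hs, ← Real.rpow_add hs]
      congr 2
      simp
      ring
    · have e : ∀ z, g z s = 0 := by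
        intro z
        simp only [g]
        by_cases hz : ∀ i, 0 < z i
        · have : ¬ 0 < s - ∑ i, z i := by
            have := Finset.sum_nonneg fun i (_ : i ∈ Finset.univ) => (hz i).le
            linarith
          simp [positivePartRpow, this]
        · push Not at hz
          obtain ⟨i, hi⟩ := hz
          rw [Finset.prod_eq_zero (Finset.mem_univ i) (by simp [positivePartRpow, hi])]
          simp
      simp [e, positivePartRpow, hs]
  calc _ = ∫⁻ s, ∫⁻ z, g z s := by
        simp_rw [hg]
        rw [lintegral_mul_const, lintegral_positivePartRpow_mul_exp_neg
          (add_pos_of_pos_of_nonneg hb (Finset.sum_nonneg fun i _ => (ha i).le))]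
        exact ENNReal.measurable_ofReal.comp ((hm _).mul (by fun_prop))
    _ = ∫⁻ z, ∫⁻ s, g z s := (lintegral_lintegral_swap hgm.aemeasurable).symm
    _ = ∫⁻ z : ι → ℝ, ENNReal.ofReal (Real.Gamma b) * ENNReal.ofReal
          (∏ i, (positivePartRpow (a i) (z i) * Real.exp (-z i))) := by
        refine lintegral_congr fun z => ?_
        rw [← lintegral_positivePartRpow_mul_exp_neg hb,
          ← lintegral_sub_right_eq_self
            (fun y => ENNReal.ofReal (positivePartRpow b y * Real.exp (-y))) (∑ i, z i), ← lintegral_mul_const' _ _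
            ENNReal.ofReal_ne_top]
        refine lintegral_congr fun s => ?_
        rw [← ENNReal.ofReal_mul
          (mul_nonneg (positivePartRpow_nonneg _ _) (Real.exp_pos _).le),
          Finset.prod_mul_distrib, ← Real.exp_sum, Finset.sum_neg_distrib]
        simp only [g]
        congr 1
        have : Real.exp (-s) = Real.exp (-(s - ∑ i, z i)) * Real.exp (-∑ i, z i) := by
          rw [← Real.exp_add]; congr 1; ring
        rw [this]
        ring
    _ = _ := by
        rw [lintegral_const_mul' _ _ ENNReal.ofReal_ne_top,
          lintegral_prod_positivePartRpow_mul_exp_neg ha,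
          ENNReal.ofReal_mul (Real.Gamma_pos_of_pos hb).le]

/-! ### Moments of the Dirichlet distribution -/

theorem measurable_dirichletDensity {Ξ : Type*} [Fintype Ξ] (a : Ξ → ℝ) :
    Measurable (dirichletDensity a) := by
  unfold dirichletDensity
  exact measurable_const.mul (Finset.measurable_prod _ fun i _ => by fun_prop)

theorem simplexPoint_self {Ξ : Type*} [Fintype Ξ] [DecidableEq Ξ] (ξ₀ : Ξ)
    (β : {ξ : Ξ // ξ ≠ ξ₀} → ℝ) : simplexPoint ξ₀ β ξ₀ = 1 - ∑ η, β η := by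
  simp [simplexPoint]

theorem simplexPoint_coe {Ξ : Type*} [Fintype Ξ] [DecidableEq Ξ] (ξ₀ : Ξ)
    (β : {ξ : Ξ // ξ ≠ ξ₀} → ℝ) (η : {ξ : Ξ // ξ ≠ ξ₀}) : simplexPoint ξ₀ β η = β η := by
  simp [simplexPoint, η.2]

theorem sum_simplexPoint {Ξ : Type*} [Fintype Ξ] [DecidableEq Ξ] (ξ₀ : Ξ)
    (β : {ξ : Ξ // ξ ≠ ξ₀} → ℝ) : ∑ ξ, simplexPoint ξ₀ β ξ = 1 := by
  rw [Fintype.sum_eq_add_sum_subtype_ne _ ξ₀, simplexPoint_self]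
  simp_rw [simplexPoint_coe]
  ring

/-- Lower bound for the moments of the Dirichlet distribution (in fact an equality). -/
theorem le_lintegral_prod_pow_dirichletMeasure {Ξ : Type*} [Fintype Ξ] [DecidableEq Ξ] (ξ₀ : Ξ)
    {a : Ξ → ℝ} (ha : ∀ ξ, 0 < a ξ) (m : Ξ → ℕ) :
    ENNReal.ofReal (Real.Gamma (∑ ξ, a ξ) / (∏ ξ, Real.Gamma (a ξ)) *
        ((∏ ξ, Real.Gamma (m ξ + a ξ)) / Real.Gamma (∑ ξ, (m ξ + a ξ)))) ≤
      ∫⁻ α in stdSimplex ℝ Ξ, ∏ ξ, ENNReal.ofReal (α ξ) ^ m ξ ∂(dirichletMeasure ξ₀ a) := by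
  have hS : MeasurableSet (stdSimplex ℝ Ξ) := (isClosed_stdSimplex ℝ Ξ).measurableSet
  have hb : ∀ ξ, 0 < (m ξ + a ξ : ℝ) := fun ξ => add_pos_of_nonneg_of_pos (by positivity) (ha ξ)
  have hsum : 0 < ∑ ξ, (m ξ + a ξ : ℝ) := Finset.sum_pos (fun ξ _ => hb ξ) ⟨ξ₀, Finset.mem_univ _⟩
  have hsuma : 0 < ∑ ξ, a ξ := Finset.sum_pos (fun ξ _ => ha ξ) ⟨ξ₀, Finset.mem_univ _⟩
  have hG := Real.Gamma_pos_of_pos hsum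
  set K := Real.Gamma (∑ ξ, a ξ) / (∏ ξ, Real.Gamma (a ξ)) with hK
  have hK0 : 0 ≤ K := div_nonneg (Real.Gamma_pos_of_pos hsuma).le
    (Finset.prod_nonneg fun ξ _ => (Real.Gamma_pos_of_pos (ha ξ)).le)
  have hmp : Measurable fun α : Ξ → ℝ => ∏ ξ, ENNReal.ofReal (α ξ) ^ m ξ :=
    Finset.measurable_prod _ fun i _ => by fun_prop
  have hmd : Measurable fun α : Ξ → ℝ => ENNReal.ofReal (dirichletDensity a α) :=
    ENNReal.measurable_ofReal.comp (measurable_dirichletDensity a)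
  have hD := dirichlet_lintegral (ι := {ξ : Ξ // ξ ≠ ξ₀}) (a := fun η => m η + a η)
    (fun η => hb η) (hb ξ₀)
  rw [← Fintype.sum_eq_add_sum_subtype_ne (fun ξ => (m ξ + a ξ : ℝ)) ξ₀,
    ← Fintype.prod_eq_mul_prod_subtype_ne (fun ξ => Real.Gamma (m ξ + a ξ)) ξ₀] at hD
  have hne : ENNReal.ofReal (Real.Gamma (∑ ξ, (m ξ + a ξ))) ≠ 0 := by simpa using hG
  have hD' : ENNReal.ofReal ((∏ ξ, Real.Gamma (m ξ + a ξ)) / Real.Gamma (∑ ξ, (m ξ + a ξ))) =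
      ∫⁻ z : {ξ : Ξ // ξ ≠ ξ₀} → ℝ, ENNReal.ofReal
        (positivePartRpow (m ξ₀ + a ξ₀) (1 - ∑ i, z i) *
          ∏ i : {ξ : Ξ // ξ ≠ ξ₀}, positivePartRpow (m i + a i) (z i)) := by
    rw [ENNReal.ofReal_div_of_pos hG, ← hD, mul_comm, ENNReal.mul_div_cancel_right hne
      ENNReal.ofReal_ne_top]
  rw [dirichletMeasure, simplexVolume, restrict_withDensity hS, Measure.restrict_restrict hS,
    inter_self, lintegral_withDensity_eq_lintegral_mul _ hmd hmp, ← lintegral_indicator hS,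
    lintegral_map ((hmd.mul hmp).indicator hS) (measurable_simplexPoint ξ₀),
    ENNReal.ofReal_mul hK0, hD', ← lintegral_const_mul' _ _ ENNReal.ofReal_ne_top]
  -- Where some weight is nonpositive the left integrand vanishes, so the inequality needs no
  -- null-set argument for the boundary.
  refine lintegral_mono fun z => ?_
  by_cases hz : ∀ ξ, 0 < simplexPoint ξ₀ z ξ
  · have hmem : simplexPoint ξ₀ z ∈ stdSimplex ℝ Ξ :=
      ⟨fun ξ => (hz ξ).le, sum_simplexPoint ξ₀ z⟩
    rw [indicator_of_mem hmem, ← ENNReal.ofReal_mul hK0, Pi.mul_apply]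
    simp_rw [← ENNReal.ofReal_pow (hz _).le]
    rw [← ENNReal.ofReal_prod_of_nonneg fun ξ _ => pow_nonneg (hz ξ).le _,
      ← ENNReal.ofReal_mul' (Finset.prod_nonneg fun ξ _ => pow_nonneg (hz ξ).le _)]
    have e : positivePartRpow (m ξ₀ + a ξ₀) (1 - ∑ i, z i) *
        ∏ i : {ξ : Ξ // ξ ≠ ξ₀}, positivePartRpow (m i + a i) (z i) =
        ∏ ξ, positivePartRpow (m ξ + a ξ) (simplexPoint ξ₀ z ξ) := by
      rw [Fintype.prod_eq_mul_prod_subtype_ne _ ξ₀, simplexPoint_self]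
      simp_rw [simplexPoint_coe]
    rw [e, dirichletDensity, ← hK, mul_assoc, ← Finset.prod_mul_distrib]
    refine le_of_eq ?_
    congr 2
    refine Finset.prod_congr rfl fun ξ _ => ?_
    rw [positivePartRpow, if_pos (hz ξ), ← Real.rpow_natCast, ← Real.rpow_add (hz ξ)]
    congr 1
    ring
  · push Not at hz
    obtain ⟨ξ, hξ⟩ := hz
    by_cases h : ξ = ξ₀
    · subst h
      rw [simplexPoint_self] at hξ
      simp [positivePartRpow, not_lt.2 hξ]
    · lift ξ to {ξ : Ξ // ξ ≠ ξ₀} using h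
      rw [simplexPoint_coe] at hξ
      rw [Finset.prod_eq_zero (Finset.mem_univ ξ) (by simp [positivePartRpow, not_lt.2 hξ])]
      simp

/-! ### Elementwise mixtures and the regret bound -/

/-- Here `p` selects an expert for each round; grouping rounds by expert collects the powers of the
weights. -/
theorem elementwiseMixture_eq_sum {Ξ X : Type*} [Fintype Ξ] [DecidableEq Ξ]
    (P : Ξ → ForecastingSystem X) (α : Ξ → ℝ) {n : ℕ} (x : Fin n → X) :
    elementwiseMixture P α x = ∑ p : Fin n → Ξ,
      (∏ i, P (p i) ((List.ofFn x).take i) (x i)) *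
        ∏ ξ, ENNReal.ofReal (α ξ) ^ Fintype.card {i // p i = ξ} := by
  simp only [elementwiseMixture, mixturePrediction]
  rw [Finset.prod_univ_sum, Fintype.piFinset_univ]
  refine Finset.sum_congr rfl fun p _ => ?_
  rw [Finset.prod_mul_distrib]
  congr 1
  rw [← Finset.prod_fiberwise Finset.univ p]
  refine Finset.prod_congr rfl fun ξ _ => ?_
  rw [Finset.prod_congr rfl (g := fun _ => ENNReal.ofReal (α ξ))
    (fun i hi => by rw [(Finset.mem_filter.1 hi).2]), Finset.prod_const, Fintype.card_subtype]

theorem continuous_elementwiseMixture {Ξ X : Type*} [Fintype Ξ]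
    (P : Ξ → ForecastingSystem X) {n : ℕ} (x : Fin n → X) :
    Continuous fun α : Ξ → ℝ => elementwiseMixture P α x := by
  -- Multiplication on `ℝ≥0∞` is discontinuous at `(0, ∞)`; all factors being finite, the
  -- computation moves to `NNReal`.
  have h : (fun α : Ξ → ℝ => elementwiseMixture P α x) = fun α =>
      ((∏ i : Fin n, ∑ ξ, (P ξ ((List.ofFn x).take i) (x i)).toNNReal * (α ξ).toNNReal :
        NNReal) : ℝ≥0∞) := by
    ext α
    simp only [elementwiseMixture, mixturePrediction, ENNReal.ofNNReal_finsetProd,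
      ENNReal.ofNNReal_finsetSum, ENNReal.coe_mul, ENNReal.coe_toNNReal (PMF.apply_ne_top _ _),
      ENNReal.ofReal]
  rw [h]
  fun_prop

theorem exists_elementwiseMixture_le {Ξ X : Type*} [Fintype Ξ] [DecidableEq Ξ] (ξ₀ : Ξ)
    (P : Ξ → ForecastingSystem X) {n : ℕ} (x : Fin n → X) :
    ∃ α ∈ stdSimplex ℝ Ξ, ∀ β ∈ stdSimplex ℝ Ξ,
      elementwiseMixture P β x ≤ elementwiseMixture P α x :=
  (isCompact_stdSimplex ℝ Ξ).exists_isMaxOn ⟨_, single_mem_stdSimplex ℝ ξ₀⟩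
    (continuous_elementwiseMixture P x).continuousOn

/-- Up to the factor `n ^ ((k - 1) / 2)`, the Dirichlet `(1/2, …, 1/2)` moments dominate the
largest value of the corresponding monomial on the simplex. -/
theorem exists_le_mul_lintegral_jeffreysPrior (k : ℕ) (hk : 1 ≤ k) :
    ∃ C : ℝ, 0 < C ∧ ∀ (Ξ : Type*) [Fintype Ξ] [DecidableEq Ξ] (ξ₀ : Ξ), Fintype.card Ξ = k →
      ∀ n : ℕ, 1 ≤ n → ∀ m : Ξ → ℕ, ∑ ξ, m ξ = n → ∀ α ∈ stdSimplex ℝ Ξ,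
        ENNReal.ofReal (C / (n : ℝ) ^ (((k : ℝ) - 1) / 2)) * ∏ ξ, ENNReal.ofReal (α ξ) ^ m ξ ≤
          ∫⁻ β in stdSimplex ℝ Ξ, ∏ ξ, ENNReal.ofReal (β ξ) ^ m ξ ∂(jeffreysPrior ξ₀) := by
  obtain ⟨C, hC, hCn⟩ := exists_Gamma_nat_add_half_mul_le k
  have hk' : (0 : ℝ) < k := by exact_mod_cast hk
  set A := Real.Gamma (k / 2) / Real.Gamma (1 / 2) ^ k with hA
  have hA0 : 0 < A := div_pos (Real.Gamma_pos_of_pos (by positivity))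
    (pow_pos (Real.Gamma_pos_of_pos (by norm_num)) _)
  refine ⟨A / C, div_pos hA0 hC, fun Ξ _ _ ξ₀ hcard n hn m hm α hα => ?_⟩
  refine le_trans ?_ (le_lintegral_prod_pow_dirichletMeasure ξ₀ (a := fun _ => 1 / 2)
    (fun _ => by norm_num) m)
  have hn0 : (0 : ℝ) < n := by exact_mod_cast hn
  simp_rw [← ENNReal.ofReal_pow (hα.1 _)]
  rw [← ENNReal.ofReal_prod_of_nonneg fun ξ _ => pow_nonneg (hα.1 ξ) _,
    ← ENNReal.ofReal_mul (by positivity)]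
  refine ENNReal.ofReal_le_ofReal ?_
  have e1 : ∑ _ξ : Ξ, (1 / 2 : ℝ) = k / 2 := by simp [hcard]; ring
  have e2 : ∑ ξ : Ξ, ((m ξ : ℝ) + 1 / 2) = n + k / 2 := by
    rw [Finset.sum_add_distrib, e1, ← Nat.cast_sum, hm]
  have e3 : ∏ _ξ : Ξ, Real.Gamma (1 / 2) = Real.Gamma (1 / 2) ^ k := by simp [hcard]
  rw [e1, e2, e3, ← hA]
  have hΓ := hCn n hn
  have hprod : (n / Real.exp 1) ^ n * ∏ ξ, α ξ ^ m ξ ≤ ∏ ξ, Real.Gamma (m ξ + 1 / 2) := by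
    -- Since the weights sum to one, the exponentials multiply to `exp (-n)`.
    calc (n / Real.exp 1) ^ n * ∏ ξ, α ξ ^ m ξ
        = ∏ ξ, ((n * α ξ) ^ m ξ * Real.exp (-(n * α ξ))) := by
          simp_rw [mul_pow, Finset.prod_mul_distrib]
          rw [Finset.prod_pow_eq_pow_sum, hm, ← Real.exp_sum, Finset.sum_neg_distrib,
            ← Finset.mul_sum, hα.2, mul_one, div_pow, ← Real.exp_nat_mul, mul_one, Real.exp_neg]
          ring
      _ ≤ _ := Finset.prod_le_prod
          (fun ξ _ => mul_nonneg (pow_nonneg (mul_nonneg hn0.le (hα.1 ξ)) _) (Real.exp_pos _).le)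
          fun ξ _ => pow_mul_exp_neg_le_Gamma_add_half _ (mul_nonneg hn0.le (hα.1 ξ))
  have hG : 0 < Real.Gamma (n + k / 2) := Real.Gamma_pos_of_pos (by positivity)
  have hpα : 0 ≤ ∏ ξ, α ξ ^ m ξ := Finset.prod_nonneg fun ξ _ => pow_nonneg (hα.1 ξ) _
  have hr : 0 < (n : ℝ) ^ (((k : ℝ) - 1) / 2) := Real.rpow_pos_of_pos hn0 _
  calc A / C / (n : ℝ) ^ (((k : ℝ) - 1) / 2) * ∏ ξ, α ξ ^ m ξ
      = A * (((n / Real.exp 1) ^ n * ∏ ξ, α ξ ^ m ξ) /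
          (C * (n / Real.exp 1) ^ n * (n : ℝ) ^ (((k : ℝ) - 1) / 2))) := by
        have : (n / Real.exp 1) ^ n ≠ 0 := by positivity
        field_simp
    _ ≤ A * ((∏ ξ, Real.Gamma (m ξ + 1 / 2)) / Real.Gamma (n + k / 2)) := by
        gcongr

theorem exists_mul_elementwiseMixture_le_universalMixture (k : ℕ) (hk : 1 ≤ k) :
    ∃ C : ℝ, 0 < C ∧ ∀ (Ξ : Type*) [Fintype Ξ] [DecidableEq Ξ] (ξ₀ : Ξ), Fintype.card Ξ = k →
      ∀ (X : Type*) (P : Ξ → ForecastingSystem X) (n : ℕ), 1 ≤ n → ∀ x : Fin n → X,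
        ∀ α ∈ stdSimplex ℝ Ξ,
        ENNReal.ofReal (C / (n : ℝ) ^ (((k : ℝ) - 1) / 2)) * elementwiseMixture P α x ≤
          universalMixture (jeffreysPrior ξ₀) P x := by
  obtain ⟨C, hC, h⟩ := exists_le_mul_lintegral_jeffreysPrior k hk
  refine ⟨C, hC, fun Ξ _ _ ξ₀ hcard X P n hn x α hα => ?_⟩
  simp only [universalMixture, elementwiseMixture_eq_sum]
  have hmp : ∀ m : Ξ → ℕ, Measurable fun α : Ξ → ℝ => ∏ ξ, ENNReal.ofReal (α ξ) ^ m ξ :=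
    fun m => Finset.measurable_prod _ fun i _ => by fun_prop
  rw [lintegral_finsetSum _ fun p _ => (hmp _).const_mul _, Finset.mul_sum]
  refine Finset.sum_le_sum fun p _ => ?_
  rw [lintegral_const_mul _ (hmp _), mul_left_comm]
  refine mul_le_mul_right (h Ξ ξ₀ hcard n hn _ ?_ α hα) _
  simp_rw [Fintype.card_subtype]
  rw [← Finset.card_eq_sum_card_fiberwise fun _ _ => Finset.mem_univ _]
  simp

theorem mainTheorem3 (k : ℕ) :
    ∃ c : ℝ, ∀ (Ξ : Type*) [Fintype Ξ] [DecidableEq Ξ] (ξ₀ : Ξ), Fintype.card Ξ = k →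
      ∀ (X : Type*) [Countable X] (P : Ξ → ForecastingSystem X)
        (n : ℕ), 1 ≤ n → ∀ x : Fin n → X,
        ∃ L : EReal,
          IsLeast ((fun α : Ξ → ℝ => logLoss (elementwiseMixture P α x)) '' stdSimplex ℝ Ξ) L ∧
          logLoss (universalMixture (jeffreysPrior ξ₀) P x) ≤
            L + (((((k : ℝ) - 1) / 2) * Real.log ((n : ℝ) / Real.pi) + c : ℝ) : EReal) := by
  rcases Nat.eq_zero_or_pos k with rfl | hk
  · exact ⟨0, fun Ξ _ _ ξ₀ hcard => ((Fintype.card_eq_zero_iff.1 hcard).false ξ₀).elim⟩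
  obtain ⟨C, hC, h⟩ := exists_mul_elementwiseMixture_le_universalMixture k hk
  -- The first term cancels the `π` in `log (n / π)`.
  refine ⟨(((k : ℝ) - 1) / 2) * Real.log Real.pi - Real.log C,
    fun Ξ _ _ ξ₀ hcard X _ P n hn x => ?_⟩
  obtain ⟨α, hα, hmax⟩ := exists_elementwiseMixture_le ξ₀ P x
  refine ⟨logLoss (elementwiseMixture P α x), ⟨⟨α, hα, rfl⟩, ?_⟩, ?_⟩
  · rintro _ ⟨β, hβ, rfl⟩
    exact EReal.neg_le_neg_iff.2 (ENNReal.log_monotone (hmax β hβ))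
  have hn0 : (0 : ℝ) < n := by exact_mod_cast hn
  have hr : 0 < (n : ℝ) ^ (((k : ℝ) - 1) / 2) := Real.rpow_pos_of_pos hn0 _
  have hlog := ENNReal.log_monotone (h Ξ ξ₀ hcard X P n hn x α hα)
  rw [ENNReal.log_mul_add, ENNReal.log_ofReal_of_pos (div_pos hC hr),
    Real.log_div hC.ne' hr.ne', Real.log_rpow hn0] at hlog
  have e : (((k : ℝ) - 1) / 2) * Real.log ((n : ℝ) / Real.pi) +
      ((((k : ℝ) - 1) / 2) * Real.log Real.pi - Real.log C) =
      -(Real.log C - (((k : ℝ) - 1) / 2) * Real.log n) := by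
    rw [Real.log_div hn0.ne' Real.pi_ne_zero]
    ring
  rw [e, logLoss, logLoss]
  refine (EReal.neg_le_neg_iff.2 hlog).trans_eq ?_
  -- One summand is real, so negation distributes even when the minimal loss is `⊤`.
  rw [EReal.neg_add (Or.inl (EReal.coe_ne_bot _)) (Or.inl (EReal.coe_ne_top _)), EReal.coe_neg,
    add_comm, sub_eq_add_neg, add_comm]
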